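/- Let $k\in[0,1)$, $\lambda>0$ and $s\ge 1$. Put $\nu=\frac{1}{2(1-k)}$ and $\phi_k(t)=\frac{t^{1-k}}{1-k}$ for $t>0$, and let $\mathrm I_\mu,\mathrm K_\mu$ denote the modified Bessel functions of order $\mu$ of the first and second kind. For $t\ge s$ define $$y_0(t,s;\lambda,k)=\lambda\,(t/s)^{1/2}\,\phi_k(s)\big[\mathrm I_{\nu-1}(\lambda\phi_k(s))\,\mathrm K_{\nu}(\lambda\phi_k(t))+\mathrm K_{\nu-1}(\lambda\phi_k(s))\,\mathrm I_{\nu}(\lambda\phi_k(t))\big],$$ $$y_1(t,s;\lambda,k)=(1-k)^{-1}(st)^{1/2}\big[\mathrm K_{\nu}(\lambda\phi_k(s))\,\mathrm I_{\nu}(\lambda\phi_k(t))-\mathrm I_{\nu}(\lambda\phi_k(s))\,\mathrm K_{\nu}(\lambda\phi_k(t))\big].$$ Then $y_0(\cdot,s;\lambda,k)$ is the unique solution on $[s,\infty)$ of the Cauchy problem $y''(t)-\lambda^2t^{-2k}y(t)=0$ for $t>s$, $y(s)=1$, $y'(s)=0$, and $y_1(\cdot,s;\lambda,k)$ is the unique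 solution on $[s,\infty)$ of the Cauchy problem $y''(t)-\lambda^2t^{-2k}y(t)=0$ for $t>s$, $y(s)=0$, $y'(s)=1$. Here a solution is a real-valued function that is $C^1$ on $[s,\infty)$, with the one-sided derivative at $s$, and twice differentiable on $(s,\infty)$. -/

import Mathlib

noncomputable section

namespace EdeS

/-- Modified Bessel function of the first kind of real order `ν` at `x > 0`:
`I_ν(x) = ∑ₘ (x/2)^(2m+ν) / (m! Γ(m+ν+1))`. At a pole of `Γ` Mathlib sets `Real.Gamma` to be `0`,
so that the summand is then `0`, in agreement with the convention that `1/Γ` vanishes there. -/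
def besselI (ν x : ℝ) : ℝ :=
  ∑' m : ℕ, (x / 2) ^ (2 * (m : ℝ) + ν) / ((m.factorial : ℝ) * Real.Gamma ((m : ℝ) + ν + 1))

/-- Modified Bessel function of the second kind (Macdonald function) of real order `ν` at `x > 0`,
for all orders, integer or not: `K_ν(x) = ∫₀^∞ exp(-x cosh u) cosh(ν u) du`. -/
def besselK (ν x : ℝ) : ℝ :=
  ∫ u in Set.Ioi (0 : ℝ), Real.exp (-x * Real.cosh u) * Real.cosh (ν * u)

/-- `φ_k(t) = t^(1-k) / (1-k)`. -/
def phi (k t : ℝ) : ℝ := t ^ (1 - k) / (1 - k)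

/-- `ν = 1 / (2(1-k))`. -/
def nu (k : ℝ) : ℝ := 1 / (2 * (1 - k))

/-- The function `y₀(t, s; lam, k)`. -/
def y0 (lam k s t : ℝ) : ℝ :=
  lam * (t / s) ^ (1 / 2 : ℝ) * phi k s *
    (besselI (nu k - 1) (lam * phi k s) * besselK (nu k) (lam * phi k t) +
      besselK (nu k - 1) (lam * phi k s) * besselI (nu k) (lam * phi k t))

/-- The function `y₁(t, s; lam, k)`. -/
def y1 (lam k s t : ℝ) : ℝ :=
  (1 - k)⁻¹ * (s * t) ^ (1 / 2 : ℝ) *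
    (besselK (nu k) (lam * phi k s) * besselI (nu k) (lam * phi k t) -
      besselI (nu k) (lam * phi k s) * besselK (nu k) (lam * phi k t))

/-- `y` is a classical solution of `y'' - lam² t^(-2k) y = 0` for `t > s`, with `y(s) = a` and
`y'(s) = b`: it is `C¹` on `[s, ∞)` (one-sided derivative at `s`), twice differentiable on
`(s, ∞)`, and satisfies the equation there. Only the values of `y` on `[s, ∞)` matter. -/
def IsCauchySolution (lam k s a b : ℝ) (y : ℝ → ℝ) : Prop :=
  ∃ y' y'' : ℝ → ℝ,
    (∀ t, s ≤ t → HasDerivWithinAt y (y' t) (Set.Ici s) t) ∧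
    ContinuousOn y' (Set.Ici s) ∧
    (∀ t, s < t → HasDerivAt y' (y'' t) t) ∧
    (∀ t, s < t → y'' t - lam ^ 2 * t ^ (-2 * k) * y t = 0) ∧
    y s = a ∧ y' s = b

end EdeS

end

/-!
The power series of `I_ν` and the integral `K_ν(x) = ½ ∫_ℝ exp(-x cosh u + ν u) du` both give the
derivative recurrences connecting orders `ν - 1`, `ν`, `ν + 1`. They turn `√t Z(λ φ_k(t))`, for a
combination `Z` of `I_ν` and `K_ν`, into a solution of the equation. The normalization at `s` is
the identity `x (I_{ν-1}(x) K_ν(x) + K_{ν-1}(x) I_ν(x)) = 1`: the left side is constant in `x`, by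
the recurrences it is periodic in `ν` with period `1`, and for `ν > 1` its limit at `0⁺` follows
from the leading behaviour `I_ν(x) ~ (x/2)^ν / Γ(ν+1)` and `K_ν(x) ~ Γ(ν) (x/2)^(-ν) / 2`.

Uniqueness needs no estimate: the Wronskian of two solutions is constant, and since `y₀`, `y₁` have
Wronskian `1`, every solution is the combination of them prescribed by its Cauchy data.
-/

open Filter MeasureTheory Real Set
open scoped Topology

namespace EdeS

section BesselClifford

variable (ν z : ℝ) (m : ℕ)

/-- The general term of the Bessel–Clifford series. -/
noncomputable def besselCliffordTerm : ℝ :=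
  z ^ m / (m.factorial * Gamma (m + ν + 1))

/-- The Bessel–Clifford function `C_ν(z) = ∑ₘ z^m / (m! Γ(m+ν+1))`, the entire function for which
`I_ν(x) = (x/2)^ν C_ν(x²/4)`. At the poles of `Γ`, Mathlib's value `Γ = 0` makes the summand `0`. -/
noncomputable def besselClifford : ℝ :=
  ∑' m : ℕ, besselCliffordTerm ν z m

/-- Valid also at the poles, where `Real.Gamma` is `0` by convention. -/
lemma inv_Gamma_eq_self_mul_inv_Gamma_add_one (a : ℝ) : (Gamma a)⁻¹ = a * (Gamma (a + 1))⁻¹ := by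
  rcases eq_or_ne a 0 with rfl | ha
  · simp
  · rw [Gamma_add_one ha, mul_inv, mul_inv_cancel_left₀ ha]

lemma succ_mul_besselCliffordTerm_succ :
    (m + 1) * besselCliffordTerm ν z (m + 1) = z * besselCliffordTerm (ν + 1) z m := by
  rw [besselCliffordTerm, besselCliffordTerm, Nat.factorial_succ, pow_succ]
  push_cast
  rw [show (m : ℝ) + 1 + ν + 1 = m + (ν + 1) + 1 by ring]
  field_simp

lemma besselCliffordTerm_eq_mul :
    besselCliffordTerm ν z m = (m + ν + 1) * besselCliffordTerm (ν + 1) z m := by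
  simp only [besselCliffordTerm, div_eq_mul_inv, mul_inv,
    inv_Gamma_eq_self_mul_inv_Gamma_add_one (m + ν + 1)]
  rw [show (m : ℝ) + (ν + 1) + 1 = m + ν + 1 + 1 by ring]
  ring

lemma summable_besselCliffordTerm : Summable (besselCliffordTerm ν z) := by
  refine summable_of_ratio_norm_eventually_le (r := 1 / 2) (by norm_num) ?_
  have hratio : Tendsto (fun m : ℕ => ((m : ℝ) + 1) * (m + ν + 1)) atTop atTop :=
    (tendsto_natCast_atTop_atTop.atTop_add tendsto_const_nhds).atTop_mul_atTop₀
      ((tendsto_natCast_atTop_atTop.atTop_add tendsto_const_nhds).atTop_add tendsto_const_nhds)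
  filter_upwards [hratio.eventually_ge_atTop (2 * |z| + 1)] with m hm
  have hrec : (m + 1) * (m + ν + 1) * besselCliffordTerm ν z (m + 1) =
      z * besselCliffordTerm ν z m := by
    rw [besselCliffordTerm_eq_mul ν z m]
    linear_combination (m + ν + 1) * succ_mul_besselCliffordTerm_succ ν z m
  have hpos : 0 < (m + 1) * (m + ν + 1) := by linarith [abs_nonneg z]
  have hnorm := congrArg norm hrec
  rw [norm_mul, norm_mul z, norm_of_nonneg hpos.le, norm_eq_abs z] at hnorm
  nlinarith [norm_nonneg (besselCliffordTerm ν z (m + 1)), norm_nonneg (besselCliffordTerm ν z m)]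

lemma hasSum_natCast_mul_besselCliffordTerm :
    HasSum (fun m : ℕ => m * besselCliffordTerm ν z m) (z * besselClifford (ν + 1) z) := by
  rw [← hasSum_nat_add_iff' 1]
  simpa [succ_mul_besselCliffordTerm_succ, besselClifford] using
    (summable_besselCliffordTerm (ν + 1) z).hasSum.mul_left z

lemma besselClifford_recurrence :
    besselClifford ν z = z * besselClifford (ν + 2) z + (ν + 1) * besselClifford (ν + 1) z := by
  have h := (hasSum_natCast_mul_besselCliffordTerm (ν + 1) z).add
    ((summable_besselCliffordTerm (ν + 1) z).hasSum.mul_left (ν + 1))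
  rw [show ν + 1 + 1 = ν + 2 by ring] at h
  rw [← besselClifford] at h
  refine Eq.trans (tsum_congr fun m => ?_) h.tsum_eq
  rw [besselCliffordTerm_eq_mul]
  ring

lemma hasDerivAt_besselCliffordTerm_succ :
    HasDerivAt (fun z => besselCliffordTerm ν z (m + 1)) (besselCliffordTerm (ν + 1) z m) z := by
  refine ((hasDerivAt_pow (m + 1) z).div_const _).congr_deriv ?_
  rw [besselCliffordTerm, Nat.factorial_succ, Nat.add_sub_cancel]
  push_cast
  rw [show (m : ℝ) + 1 + ν + 1 = m + (ν + 1) + 1 by ring]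
  field_simp

lemma hasDerivAt_besselClifford :
    HasDerivAt (besselClifford ν) (besselClifford (ν + 1) z) z := by
  set R := |z| + 1
  have hsum (w : ℝ) : Summable fun m => besselCliffordTerm ν w (m + 1) :=
    (summable_nat_add_iff 1).2 (summable_besselCliffordTerm ν w)
  have hbound (m : ℕ) (w : ℝ) (hw : w ∈ Metric.ball (0 : ℝ) R) :
      ‖besselCliffordTerm (ν + 1) w m‖ ≤ ‖besselCliffordTerm (ν + 1) R m‖ := by
    have hwR : |w| ≤ |R| := (mem_ball_zero_iff.1 hw).le.trans (le_abs_self R)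
    simp only [besselCliffordTerm, norm_div, norm_pow, norm_eq_abs]
    gcongr
  have hz : z ∈ Metric.ball (0 : ℝ) R := mem_ball_zero_iff.2 (lt_add_one |z|)
  have htail := hasDerivAt_tsum_of_isPreconnected (summable_besselCliffordTerm (ν + 1) R).norm
    Metric.isOpen_ball (convex_ball (0 : ℝ) R).isPreconnected
    (fun m w _ => hasDerivAt_besselCliffordTerm_succ ν w m) hbound hz (hsum z) hz
  refine (htail.const_add (besselCliffordTerm ν 0 0)).congr_of_eventuallyEq
    (Eventually.of_forall fun w => ?_)
  rw [besselClifford, (summable_besselCliffordTerm ν w).tsum_eq_zero_add]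
  simp [besselCliffordTerm]

lemma besselClifford_zero : besselClifford ν 0 = (Gamma (ν + 1))⁻¹ := by
  rw [besselClifford, tsum_eq_single 0 fun m hm => by simp [besselCliffordTerm, hm]]
  simp [besselCliffordTerm]

end BesselClifford

section BesselI

variable {ν x : ℝ}

lemma besselI_eq_rpow_mul_besselClifford (hx : 0 < x) :
    besselI ν x = (x / 2) ^ ν * besselClifford ν ((x / 2) ^ 2) := by
  rw [besselI, besselClifford, ← tsum_mul_left]
  refine tsum_congr fun m => ?_
  rw [rpow_add (by positivity), besselCliffordTerm, ← pow_mul, ← rpow_natCast]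
  push_cast
  ring

lemma besselI_sub_one (hx : 0 < x) :
    besselI (ν - 1) x = besselI (ν + 1) x + 2 * ν / x * besselI ν x := by
  simp only [besselI_eq_rpow_mul_besselClifford hx]
  rw [rpow_add_one (by positivity), rpow_sub_one (by positivity), besselClifford_recurrence,
    sub_add_cancel, show ν - 1 + 2 = ν + 1 by ring]
  field_simp

lemma hasDerivAt_besselI_add_one (hx : 0 < x) :
    HasDerivAt (besselI ν) (ν / x * besselI ν x + besselI (ν + 1) x) x := by
  have hhalf : HasDerivAt (fun x : ℝ => x / 2) (1 / 2) x := (hasDerivAt_id x).div_const 2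
  have hC := HasDerivAt.comp (h₂ := besselClifford ν) (h := fun x : ℝ => (x / 2) ^ 2) x
    (hasDerivAt_besselClifford ν _) (hhalf.fun_pow 2)
  have hprod := (hhalf.rpow_const (p := ν) (Or.inl (by positivity))).mul hC
  refine (hprod.congr_of_eventuallyEq ?_).congr_deriv ?_
  · filter_upwards [lt_mem_nhds hx] with w hw using besselI_eq_rpow_mul_besselClifford hw
  · simp only [besselI_eq_rpow_mul_besselClifford hx, Function.comp_apply]
    rw [rpow_add_one (by positivity), rpow_sub_one (by positivity)]
    field_simp
    ring

lemma hasDerivAt_besselI_sub_one (hx : 0 < x) :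
    HasDerivAt (besselI ν) (besselI (ν - 1) x - ν / x * besselI ν x) x :=
  (hasDerivAt_besselI_add_one hx).congr_deriv (by rw [besselI_sub_one hx]; ring)

lemma tendsto_rpow_neg_mul_besselI (ν : ℝ) :
    Tendsto (fun x => (x / 2) ^ (-ν) * besselI ν x) (𝓝[>] 0) (𝓝 (Gamma (ν + 1))⁻¹) := by
  have hsq : Tendsto (fun x : ℝ => (x / 2) ^ 2) (𝓝[>] 0) (𝓝 0) :=
    tendsto_nhdsWithin_of_tendsto_nhds (Continuous.tendsto' (by fun_prop) 0 0 (by simp))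
  have hC := (hasDerivAt_besselClifford ν 0).continuousAt.tendsto.comp hsq
  rw [besselClifford_zero] at hC
  refine hC.congr' ?_
  filter_upwards [self_mem_nhdsWithin] with x (hx : 0 < x)
  rw [besselI_eq_rpow_mul_besselClifford hx, ← mul_assoc, ← rpow_add (by positivity),
    neg_add_cancel, rpow_zero, one_mul, Function.comp_apply]

end BesselI

section BesselK

variable {ν x : ℝ}

lemma sq_div_four_le_cosh (u : ℝ) : u ^ 2 / 4 ≤ cosh u := by
  have h := quadratic_le_exp_of_nonneg (abs_nonneg u)
  rw [← cosh_abs, cosh_eq, ← sq_abs]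
  linarith [exp_pos (-|u|), abs_nonneg u]

lemma integrable_exp_neg_mul_cosh_add (hx : 0 < x) (ν : ℝ) :
    Integrable fun u => exp (-x * cosh u + ν * u) := by
  refine ((integrable_exp_neg_mul_sq (b := x / 8) (by positivity)).const_mul
    (exp (2 * ν ^ 2 / x))).mono' (by fun_prop) (Eventually.of_forall fun u => ?_)
  rw [norm_of_nonneg (exp_pos _).le, ← exp_add, exp_le_exp]
  have hcosh := mul_le_mul_of_nonneg_left (sq_div_four_le_cosh u) hx.le
  have hsq : 2 * ν ^ 2 / x - ν * u + x / 8 * u ^ 2 = x / 8 * (u - 4 * ν / x) ^ 2 := by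
    field_simp
    ring
  have : 0 ≤ x / 8 * (u - 4 * ν / x) ^ 2 := by positivity
  linarith

lemma besselK_eq_integral_exp (hx : 0 < x) (ν : ℝ) :
    besselK ν x = (∫ u, exp (-x * cosh u + ν * u)) / 2 := by
  have hreflect : ∫ u, exp (-x * cosh u + -ν * u) = ∫ u, exp (-x * cosh u + ν * u) := by
    rw [← integral_neg_eq_self]
    simp only [cosh_neg, neg_mul_neg]
  have heven : ∫ u, exp (-x * cosh u) * cosh (ν * u) = 2 * besselK ν x := by
    rw [besselK, ← integral_comp_abs (f := fun u => exp (-x * cosh u) * cosh (ν * u))]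
    refine integral_congr_ae (Eventually.of_forall fun u => ?_)
    dsimp only
    rw [cosh_abs, ← cosh_abs (ν * |u|), abs_mul, abs_abs, ← abs_mul, cosh_abs]
  have hexp (u : ℝ) : exp (-x * cosh u) * cosh (ν * u) =
      (exp (-x * cosh u + ν * u) + exp (-x * cosh u + -ν * u)) / 2 := by
    rw [cosh_eq (ν * u), exp_add, exp_add, neg_mul ν]
    ring
  simp only [hexp] at heven
  rw [integral_div, integral_add (integrable_exp_neg_mul_cosh_add hx ν)
    (integrable_exp_neg_mul_cosh_add hx (-ν)), hreflect] at heven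
  linarith

lemma cosh_mul_exp_neg_mul_cosh_add (ν x u : ℝ) : cosh u * exp (-x * cosh u + ν * u) =
    (exp (-x * cosh u + (ν + 1) * u) + exp (-x * cosh u + (ν - 1) * u)) / 2 := by
  rw [add_one_mul, sub_one_mul, ← add_assoc, ← add_sub_assoc, exp_add _ u, sub_eq_add_neg _ u,
    exp_add _ (-u), ← mul_add, mul_div_assoc, ← cosh_eq, mul_comm]

lemma sinh_mul_exp_neg_mul_cosh_add (ν x u : ℝ) : sinh u * exp (-x * cosh u + ν * u) =
    (exp (-x * cosh u + (ν + 1) * u) - exp (-x * cosh u + (ν - 1) * u)) / 2 := by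
  rw [add_one_mul, sub_one_mul, ← add_assoc, ← add_sub_assoc, exp_add _ u, sub_eq_add_neg _ u,
    exp_add _ (-u), ← mul_sub, mul_div_assoc, ← sinh_eq, mul_comm]

lemma integrable_cosh_mul_exp_neg_mul_cosh_add (hx : 0 < x) (ν : ℝ) :
    Integrable fun u => cosh u * exp (-x * cosh u + ν * u) := by
  simp only [cosh_mul_exp_neg_mul_cosh_add]
  exact ((integrable_exp_neg_mul_cosh_add hx _).add
    (integrable_exp_neg_mul_cosh_add hx _)).div_const 2

lemma integral_cosh_mul_exp_neg_mul_cosh_add (hx : 0 < x) (ν : ℝ) :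
    ∫ u, cosh u * exp (-x * cosh u + ν * u) = besselK (ν + 1) x + besselK (ν - 1) x := by
  simp only [cosh_mul_exp_neg_mul_cosh_add]
  rw [integral_div, integral_add (integrable_exp_neg_mul_cosh_add hx _)
    (integrable_exp_neg_mul_cosh_add hx _), besselK_eq_integral_exp hx,
    besselK_eq_integral_exp hx, add_div]

lemma besselK_add_one (hx : 0 < x) :
    besselK (ν + 1) x = besselK (ν - 1) x + 2 * ν / x * besselK ν x := by
  have hint (μ : ℝ) := integrable_exp_neg_mul_cosh_add hx μ
  have hK (μ : ℝ) : ∫ u, exp (-x * cosh u + μ * u) = 2 * besselK μ x := by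
    rw [besselK_eq_integral_exp hx, mul_div_cancel₀ _ two_ne_zero]
  have hdiff : Integrable fun u => (exp (-x * cosh u + (ν + 1) * u) -
      exp (-x * cosh u + (ν - 1) * u)) / 2 := ((hint _).sub (hint _)).div_const 2
  have hderiv (u : ℝ) : HasDerivAt (fun u => exp (-x * cosh u + ν * u))
      (ν * exp (-x * cosh u + ν * u) - x * ((exp (-x * cosh u + (ν + 1) * u) -
        exp (-x * cosh u + (ν - 1) * u)) / 2)) u := by
    rw [← sinh_mul_exp_neg_mul_cosh_add]
    exact (((hasDerivAt_cosh u).const_mul (-x)).fun_add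
      (hasDerivAt_const_mul ν)).exp.congr_deriv (by ring)
  have hzero := integral_eq_zero_of_hasDerivAt_of_integrable hderiv
    (((hint ν).const_mul ν).sub (hdiff.const_mul x)) (hint ν)
  rw [integral_sub ((hint ν).const_mul ν) (hdiff.const_mul x), integral_const_mul,
    integral_const_mul, integral_div, integral_sub (hint _) (hint _), hK, hK, hK] at hzero
  field_simp
  linarith

lemma hasDerivAt_besselK (hx : 0 < x) :
    HasDerivAt (besselK ν) (-(besselK (ν + 1) x + besselK (ν - 1) x) / 2) x := by
  have hdom : ∀ u, ∀ w ∈ Ioi (x / 2), ‖-(cosh u * exp (-w * cosh u + ν * u))‖ ≤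
      cosh u * exp (-(x / 2) * cosh u + ν * u) := by
    intro u w (hw : x / 2 < w)
    have := cosh_pos u
    rw [norm_neg, norm_of_nonneg (by positivity)]
    gcongr
  have hderiv : ∀ u, ∀ w ∈ Ioi (x / 2), HasDerivAt (fun w => exp (-w * cosh u + ν * u))
      (-(cosh u * exp (-w * cosh u + ν * u))) w := fun u w _ =>
    (((hasDerivAt_neg w).mul_const (cosh u)).add_const (ν * u)).exp.congr_deriv (by ring)
  have hint := (hasDerivAt_integral_of_dominated_loc_of_deriv_le
    (Ioi_mem_nhds (half_lt_self hx)) (Eventually.of_forall fun w => by fun_prop)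
    (integrable_exp_neg_mul_cosh_add hx ν) (by fun_prop) (Eventually.of_forall hdom)
    (integrable_cosh_mul_exp_neg_mul_cosh_add (half_pos hx) ν) (Eventually.of_forall hderiv)).2
  refine ((hint.div_const 2).congr_of_eventuallyEq ?_).congr_deriv ?_
  · filter_upwards [lt_mem_nhds hx] with w hw using besselK_eq_integral_exp hw ν
  · rw [integral_neg, integral_cosh_mul_exp_neg_mul_cosh_add hx]

lemma hasDerivAt_besselK_sub_one (hx : 0 < x) :
    HasDerivAt (besselK ν) (-besselK (ν - 1) x - ν / x * besselK ν x) x :=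
  (hasDerivAt_besselK hx).congr_deriv (by rw [besselK_add_one hx]; ring)

lemma hasDerivAt_besselK_add_one (hx : 0 < x) :
    HasDerivAt (besselK ν) (ν / x * besselK ν x - besselK (ν + 1) x) x :=
  (hasDerivAt_besselK_sub_one hx).congr_deriv (by rw [besselK_add_one hx]; ring)

lemma rpow_mul_besselK (hx : 0 < x) (ν : ℝ) : (x / 2) ^ ν * besselK ν x =
    (∫ t in Ioi 0, exp (-t) * t ^ (ν - 1) * exp (-(x / 2) ^ 2 / t)) / 2 := by
  have hx2 : 0 < x / 2 := half_pos hx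
  have himage : (fun u => x / 2 * exp u) '' univ = Ioi 0 := by
    rw [image_univ]
    ext t
    refine ⟨?_, fun (ht : 0 < t) => ⟨log (t / (x / 2)), ?_⟩⟩
    · rintro ⟨u, rfl⟩
      exact mul_pos hx2 (exp_pos u)
    · simp only
      rw [exp_log (div_pos ht hx2), mul_div_cancel₀ t hx2.ne']
  have hinj : InjOn (fun u => x / 2 * exp u) univ :=
    ((mul_right_injective₀ hx2.ne').comp exp_injective).injOn
  -- The substitution `t = (x / 2) * exp u`.
  have hsubst := integral_image_eq_integral_abs_deriv_smul MeasurableSet.univ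
    (fun u _ => ((hasDerivAt_exp u).const_mul (x / 2)).hasDerivWithinAt) hinj
    fun t => exp (-t) * t ^ (ν - 1) * exp (-(x / 2) ^ 2 / t)
  rw [himage, setIntegral_univ] at hsubst
  rw [hsubst, besselK_eq_integral_exp hx, ← mul_div_assoc, ← integral_const_mul]
  congr 2 with u
  have hpos : 0 < x / 2 * exp u := mul_pos hx2 (exp_pos u)
  have hexp : exp (-x * cosh u + ν * u) = exp (-(x / 2 * exp u)) *
      exp (-(x / 2) ^ 2 / (x / 2 * exp u)) * exp u ^ ν := by
    rw [← exp_mul, ← exp_add, ← exp_add, cosh_eq, exp_neg u]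
    congr 1
    field_simp
    ring
  rw [smul_eq_mul, abs_of_pos hpos, hexp, rpow_sub_one hpos.ne', mul_rpow hx2.le (exp_pos u).le]
  field_simp

lemma tendsto_rpow_mul_besselK (hν : 0 < ν) :
    Tendsto (fun x => (x / 2) ^ ν * besselK ν x) (𝓝[>] 0) (𝓝 (Gamma ν / 2)) := by
  have hlim : Tendsto
      (fun x => ∫ t in Ioi 0, exp (-t) * t ^ (ν - 1) * exp (-(x / 2) ^ 2 / t))
      (𝓝[>] 0) (𝓝 (Gamma ν)) := by
    rw [Gamma_eq_integral hν]
    refine tendsto_integral_filter_of_dominated_convergence (fun t => exp (-t) * t ^ (ν - 1))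
      (Eventually.of_forall fun x => by fun_prop) (Eventually.of_forall fun x => ?_)
      (GammaIntegral_convergent hν) (Eventually.of_forall fun t => ?_)
    · filter_upwards [ae_restrict_mem measurableSet_Ioi] with t (ht : 0 < t)
      rw [norm_of_nonneg (by positivity)]
      refine mul_le_of_le_one_right (by positivity) (exp_le_one_iff.2 ?_)
      exact div_nonpos_of_nonpos_of_nonneg (neg_nonpos.2 (sq_nonneg _)) ht.le
    · exact tendsto_nhdsWithin_of_tendsto_nhds (Continuous.tendsto' (by fun_prop) 0 _ (by simp))
  refine (hlim.div_const 2).congr' ?_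
  filter_upwards [self_mem_nhdsWithin] with x hx using (rpow_mul_besselK hx ν).symm

end BesselK

section Wronskian

/-- The Wronskian `K_ν I_ν' - K_ν' I_ν`, with the derivatives written in terms of
order `ν - 1`. -/
noncomputable def besselWronskian (ν x : ℝ) : ℝ :=
  besselI (ν - 1) x * besselK ν x + besselK (ν - 1) x * besselI ν x

variable {ν x : ℝ}

lemma periodic_besselWronskian (hx : 0 < x) :
    Function.Periodic (fun ν => besselWronskian ν x) 1 := by
  intro ν
  simp only [besselWronskian, add_sub_cancel_right]
  rw [besselK_add_one hx, besselI_sub_one hx]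
  ring

lemma hasDerivAt_mul_besselWronskian (hx : 0 < x) :
    HasDerivAt (fun x => x * besselWronskian ν x) 0 x := by
  refine ((hasDerivAt_id x).mul
    (((hasDerivAt_besselI_add_one hx).mul (hasDerivAt_besselK_sub_one hx)).add
      ((hasDerivAt_besselK_add_one hx).mul (hasDerivAt_besselI_sub_one hx)))).congr_deriv ?_
  simp only [id, sub_add_cancel, Pi.add_apply, Pi.mul_apply]
  field_simp
  ring

lemma tendsto_mul_besselWronskian (hν : 1 < ν) :
    Tendsto (fun x => x * besselWronskian ν x) (𝓝[>] 0) (𝓝 1) := by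
  have hν0 : 0 < ν := zero_lt_one.trans hν
  have hsq : Tendsto (fun x : ℝ => (x / 2) ^ 2) (𝓝[>] 0) (𝓝 0) :=
    tendsto_nhdsWithin_of_tendsto_nhds (Continuous.tendsto' (by fun_prop) 0 0 (by simp))
  have hmain := (tendsto_rpow_neg_mul_besselI (ν - 1)).mul (tendsto_rpow_mul_besselK hν0)
  have hrest := hsq.mul ((tendsto_rpow_mul_besselK (sub_pos.2 hν)).mul
    (tendsto_rpow_neg_mul_besselI ν))
  have hsum := (hmain.add hrest).const_mul 2
  have hlim : 2 * ((Gamma (ν - 1 + 1))⁻¹ * (Gamma ν / 2) +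
      0 * (Gamma (ν - 1) / 2 * (Gamma (ν + 1))⁻¹)) = 1 := by
    have := (Gamma_pos_of_pos hν0).ne'
    rw [sub_add_cancel]
    field_simp
    ring
  rw [hlim] at hsum
  refine hsum.congr' ?_
  filter_upwards [self_mem_nhdsWithin] with x (hx : 0 < x)
  rw [besselWronskian, rpow_neg (by positivity), rpow_neg (by positivity),
    rpow_sub_one (by positivity)]
  field_simp

lemma mul_besselWronskian_of_one_lt (hν : 1 < ν) (hx : 0 < x) : x * besselWronskian ν x = 1 := by
  have hconst : ∀ w ∈ Ioi (0 : ℝ), w * besselWronskian ν w = x * besselWronskian ν x := fun w hw =>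
    isOpen_Ioi.is_const_of_deriv_eq_zero isPreconnected_Ioi
      (fun v hv => (hasDerivAt_mul_besselWronskian hv).differentiableAt.differentiableWithinAt)
      (fun v hv => (hasDerivAt_mul_besselWronskian hv).deriv) hw hx
  refine tendsto_nhds_unique (tendsto_const_nhds.congr' ?_) (tendsto_mul_besselWronskian hν)
  filter_upwards [self_mem_nhdsWithin] with w hw using (hconst w hw).symm

lemma mul_besselWronskian (ν : ℝ) (hx : 0 < x) : x * besselWronskian ν x = 1 := by
  obtain ⟨n, hn⟩ := exists_nat_gt (1 - ν)
  have hshift := (periodic_besselWronskian hx).nat_mul n ν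
  rw [mul_one] at hshift
  rw [← hshift]
  exact mul_besselWronskian_of_one_lt (by linarith) hx

end Wronskian

section ModifiedBesselPair

/-- `(Z, Z₁)` solves on `(0, ∞)` the first-order system satisfied by `(I_ν, I_{ν-1})` and
`(K_ν, -K_{ν-1})`; eliminating `Z₁` gives the modified Bessel equation of order `ν` for `Z`. -/
structure IsModifiedBesselPair (ν : ℝ) (Z Z₁ : ℝ → ℝ) : Prop where
  hasDerivAt : ∀ x, 0 < x → HasDerivAt Z (Z₁ x - ν / x * Z x) x
  hasDerivAt_snd : ∀ x, 0 < x → HasDerivAt Z₁ ((ν - 1) / x * Z₁ x + Z x) x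

lemma isModifiedBesselPair_besselI_besselK (ν A B : ℝ) :
    IsModifiedBesselPair ν (fun x => A * besselI ν x + B * besselK ν x)
      (fun x => A * besselI (ν - 1) x - B * besselK (ν - 1) x) where
  hasDerivAt x hx :=
    (((hasDerivAt_besselI_sub_one hx).const_mul A).add
      ((hasDerivAt_besselK_sub_one hx).const_mul B)).congr_deriv (by ring)
  hasDerivAt_snd x hx := by
    refine (((hasDerivAt_besselI_add_one hx).const_mul A).sub
      ((hasDerivAt_besselK_add_one hx).const_mul B)).congr_deriv ?_
    rw [sub_add_cancel]
    ring

end ModifiedBesselPair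

section SecondOrderEquation

/-- `y` is a `C¹` solution on `[s, ∞)` of `y'' = q y`, the equation holding on `(s, ∞)`; the
derivative `y'` (one-sided at `s`) is carried as data. -/
structure IsSecondOrderSolution (q : ℝ → ℝ) (s : ℝ) (y y' : ℝ → ℝ) : Prop where
  hasDerivWithinAt : ∀ t, s ≤ t → HasDerivWithinAt y (y' t) (Ici s) t
  continuousOn_deriv : ContinuousOn y' (Ici s)
  hasDerivAt_deriv : ∀ t, s < t → HasDerivAt y' (q t * y t) t

variable {q y y' u u' v v' : ℝ → ℝ} {s t lam k a b : ℝ}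

lemma isCauchySolution_iff : IsCauchySolution lam k s a b y ↔
    ∃ y', IsSecondOrderSolution (fun t => lam ^ 2 * t ^ (-2 * k)) s y y' ∧ y s = a ∧ y' s = b := by
  constructor
  · rintro ⟨y', y'', hy, hy', hy'', heq, ha, hb⟩
    exact ⟨y', ⟨hy, hy', fun t ht => (hy'' t ht).congr_deriv (sub_eq_zero.1 (heq t ht))⟩, ha, hb⟩
  · rintro ⟨y', h, ha, hb⟩
    exact ⟨y', _, h.hasDerivWithinAt, h.continuousOn_deriv, h.hasDerivAt_deriv,
      fun t _ => sub_self _, ha, hb⟩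

namespace IsSecondOrderSolution

lemma continuousOn (hy : IsSecondOrderSolution q s y y') : ContinuousOn y (Ici s) :=
  fun t ht => (hy.hasDerivWithinAt t ht).continuousWithinAt

lemma hasDerivAt (hy : IsSecondOrderSolution q s y y') (ht : s < t) : HasDerivAt y (y' t) t :=
  (hy.hasDerivWithinAt t ht.le).hasDerivAt (Ici_mem_nhds ht)

lemma wronskian_eq (hy : IsSecondOrderSolution q s y y') (hu : IsSecondOrderSolution q s u u')
    (hst : s ≤ t) : y t * u' t - y' t * u t = y s * u' s - y' s * u s := by
  rcases hst.eq_or_lt with rfl | hlt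
  · rfl
  have hcont : ContinuousOn (fun t => y t * u' t - y' t * u t) (Icc s t) :=
    ((hy.continuousOn.mul hu.continuousOn_deriv).sub
      (hy.continuousOn_deriv.mul hu.continuousOn)).mono Icc_subset_Ici_self
  have hderiv : ∀ r ∈ Ioo s t, HasDerivAt (fun t => y t * u' t - y' t * u t) 0 r := fun r hr =>
    (((hy.hasDerivAt hr.1).mul (hu.hasDerivAt_deriv r hr.1)).sub
      ((hy.hasDerivAt_deriv r hr.1).mul (hu.hasDerivAt hr.1))).congr_deriv (by ring)
  obtain ⟨r, -, hr⟩ := exists_hasDerivAt_eq_slope _ (fun _ => 0) hlt hcont hderiv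
  rw [eq_div_iff (sub_pos.2 hlt).ne', zero_mul] at hr
  linarith

lemma eq_of_wronskian_eq_one (hy : IsSecondOrderSolution q s y y')
    (hu : IsSecondOrderSolution q s u u') (hv : IsSecondOrderSolution q s v v')
    (huv : u s * v' s - u' s * v s = 1) (hst : s ≤ t) :
    y t = (y s * v' s - y' s * v s) * u t - (y s * u' s - y' s * u s) * v t := by
  linear_combination -y t * ((hu.wronskian_eq hv hst).trans huv) -
    v t * hy.wronskian_eq hu hst + u t * hy.wronskian_eq hv hst

end IsSecondOrderSolution

lemma IsCauchySolution.eqOn (hy : IsCauchySolution lam k s a b y)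
    (hu : IsCauchySolution lam k s 1 0 u) (hv : IsCauchySolution lam k s 0 1 v) :
    EqOn y (fun t => a * u t + b * v t) (Ici s) := by
  obtain ⟨y', hysol, rfl, rfl⟩ := isCauchySolution_iff.1 hy
  obtain ⟨u', husol, hus, hus'⟩ := isCauchySolution_iff.1 hu
  obtain ⟨v', hvsol, hvs, hvs'⟩ := isCauchySolution_iff.1 hv
  intro t ht
  have h := hysol.eq_of_wronskian_eq_one husol hvsol (by rw [hus, hus', hvs, hvs']; norm_num) ht
  rw [hus, hus', hvs, hvs'] at h
  linear_combination h

end SecondOrderEquation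

section Transformation

variable {lam k s t : ℝ}

lemma phi_eq (k : ℝ) (ht : 0 < t) : phi k t = t * t ^ (-k) / (1 - k) := by
  rw [phi, sub_eq_add_neg, rpow_add ht, rpow_one]

lemma phi_pos (hk : k < 1) (ht : 0 < t) : 0 < phi k t :=
  div_pos (rpow_pos_of_pos ht _) (sub_pos.2 hk)

lemma hasDerivAt_phi (hk : k < 1) (ht : 0 < t) : HasDerivAt (phi k) (t ^ (-k)) t := by
  have hk0 : 1 - k ≠ 0 := (sub_pos.2 hk).ne'
  refine ((hasDerivAt_rpow_const (p := 1 - k) (Or.inl ht.ne')).div_const _).congr_deriv ?_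
  rw [sub_right_comm, sub_self, zero_sub, mul_div_cancel_left₀ _ hk0]

lemma hasDerivAt_comp_mul_phi (hk : k < 1) (ht : 0 < t) {Z : ℝ → ℝ} {z' : ℝ}
    (hZ : HasDerivAt Z z' (lam * phi k t)) :
    HasDerivAt (fun t => Z (lam * phi k t)) (z' * (lam * t ^ (-k))) t :=
  hZ.comp t ((hasDerivAt_phi hk ht).const_mul lam)

lemma nu_mul_one_sub (hk : k < 1) : nu k * (1 - k) = 1 / 2 := by
  have := (sub_pos.2 hk).ne'
  rw [nu]
  field_simp

lemma div_mul_phi_mul_rpow_neg (hk : k < 1) (hlam : lam ≠ 0) (ht : 0 < t) (c : ℝ) :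
    c / (lam * phi k t) * (lam * t ^ (-k)) = c * (1 - k) / t := by
  have hk0 : 1 - k ≠ 0 := (sub_pos.2 hk).ne'
  have hpow : t ^ (-k) ≠ 0 := (rpow_pos_of_pos ht _).ne'
  rw [phi_eq k ht]
  field_simp

namespace IsModifiedBesselPair

variable {Z Z₁ : ℝ → ℝ}

lemma hasDerivAt_sqrt_mul (h : IsModifiedBesselPair (nu k) Z Z₁) (hk : k < 1) (hlam : 0 < lam)
    (ht : 0 < t) : HasDerivAt (fun t => √t * Z (lam * phi k t))
      (lam * (√t * t ^ (-k)) * Z₁ (lam * phi k t)) t := by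
  have hx : 0 < lam * phi k t := mul_pos hlam (phi_pos hk ht)
  refine ((hasDerivAt_sqrt ht.ne').mul
    (hasDerivAt_comp_mul_phi hk ht (h.hasDerivAt _ hx))).congr_deriv ?_
  linear_combination -(1 / 2) * Z (lam * phi k t) * sqrt_div_self (x := t) -
    √t * Z (lam * phi k t) * div_mul_phi_mul_rpow_neg hk hlam.ne' ht (nu k) -
    √t * Z (lam * phi k t) / t * nu_mul_one_sub hk

lemma hasDerivAt_sqrt_mul_rpow_mul (h : IsModifiedBesselPair (nu k) Z Z₁) (hk : k < 1)
    (hlam : 0 < lam) (ht : 0 < t) :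
    HasDerivAt (fun t => lam * (√t * t ^ (-k)) * Z₁ (lam * phi k t))
      (lam ^ 2 * t ^ (-2 * k) * (√t * Z (lam * phi k t))) t := by
  have hx : 0 < lam * phi k t := mul_pos hlam (phi_pos hk ht)
  have hpow : t ^ (-2 * k) = t ^ (-k) * t ^ (-k) := by
    rw [← rpow_add ht]
    ring_nf
  refine ((((hasDerivAt_sqrt ht.ne').mul
    (hasDerivAt_rpow_const (p := -k) (Or.inl ht.ne'))).const_mul lam).mul
    (hasDerivAt_comp_mul_phi hk ht (h.hasDerivAt_snd _ hx))).congr_deriv ?_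
  rw [hpow, rpow_sub_one ht.ne', Pi.mul_apply]
  linear_combination lam * t ^ (-k) * Z₁ (lam * phi k t) *
    (-(1 / 2) * sqrt_div_self (x := t) +
      √t * div_mul_phi_mul_rpow_neg hk hlam.ne' ht (nu k - 1) + √t / t * nu_mul_one_sub hk)

lemma isSecondOrderSolution (h : IsModifiedBesselPair (nu k) Z Z₁) (hk : k < 1) (hlam : 0 < lam)
    (hs : 0 < s) : IsSecondOrderSolution (fun t => lam ^ 2 * t ^ (-2 * k)) s
      (fun t => √t * Z (lam * phi k t)) (fun t => lam * (√t * t ^ (-k)) * Z₁ (lam * phi k t)) where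
  hasDerivWithinAt _ ht := (h.hasDerivAt_sqrt_mul hk hlam (hs.trans_le ht)).hasDerivWithinAt
  continuousOn_deriv _ ht :=
    (h.hasDerivAt_sqrt_mul_rpow_mul hk hlam (hs.trans_le ht)).continuousAt.continuousWithinAt
  hasDerivAt_deriv _ ht := h.hasDerivAt_sqrt_mul_rpow_mul hk hlam (hs.trans ht)

end IsModifiedBesselPair

lemma isCauchySolution_of_eq_sqrt_mul (hk : k < 1) (hlam : 0 < lam) (hs : 0 < s) (A B : ℝ)
    {y : ℝ → ℝ} {a b : ℝ} (hy : ∀ t, y t =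
      √t * (A * besselI (nu k) (lam * phi k t) + B * besselK (nu k) (lam * phi k t)))
    (ha : y s = a) (hb : lam * (√s * s ^ (-k)) * (A * besselI (nu k - 1) (lam * phi k s) -
      B * besselK (nu k - 1) (lam * phi k s)) = b) :
    IsCauchySolution lam k s a b y := by
  have hsol := (isModifiedBesselPair_besselI_besselK (nu k) A B).isSecondOrderSolution hk hlam hs
  rw [← funext hy] at hsol
  exact isCauchySolution_iff.2 ⟨_, hsol, ha, hb⟩

lemma isCauchySolution_y0 (hk : k < 1) (hlam : 0 < lam) (hs : 0 < s) :
    IsCauchySolution lam k s 1 0 (y0 lam k s) := by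
  refine isCauchySolution_of_eq_sqrt_mul hk hlam hs
    (lam * phi k s / √s * besselK (nu k - 1) (lam * phi k s))
    (lam * phi k s / √s * besselI (nu k - 1) (lam * phi k s)) (fun t => ?_) ?_ (by ring)
  · rw [y0, ← sqrt_eq_rpow, sqrt_div' t hs.le]
    ring
  · rw [y0, div_self hs.ne', one_rpow, mul_one]
    exact mul_besselWronskian (nu k) (mul_pos hlam (phi_pos hk hs))

lemma isCauchySolution_y1 (hk : k < 1) (hlam : 0 < lam) (hs : 0 < s) :
    IsCauchySolution lam k s 0 1 (y1 lam k s) := by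
  refine isCauchySolution_of_eq_sqrt_mul hk hlam hs
    ((1 - k)⁻¹ * √s * besselK (nu k) (lam * phi k s))
    (-((1 - k)⁻¹ * √s * besselI (nu k) (lam * phi k s))) (fun t => ?_) (by rw [y1]; ring) ?_
  · rw [y1, ← sqrt_eq_rpow, sqrt_mul hs.le]
    ring
  · have hphi : lam * (√s * s ^ (-k)) * ((1 - k)⁻¹ * √s) = lam * phi k s := by
      rw [phi_eq k hs]
      linear_combination lam * s ^ (-k) * (1 - k)⁻¹ * mul_self_sqrt hs.le
    have hW := mul_besselWronskian (nu k) (mul_pos hlam (phi_pos hk hs))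
    rw [besselWronskian] at hW
    linear_combination hW + (besselI (nu k - 1) (lam * phi k s) * besselK (nu k) (lam * phi k s) +
      besselK (nu k - 1) (lam * phi k s) * besselI (nu k) (lam * phi k s)) * hphi

end Transformation

end EdeS

theorem proposition2p1_general (k lam s : ℝ) (hk : k < 1) (hlam : 0 < lam) (hs : 0 < s) :
    (EdeS.IsCauchySolution lam k s 1 0 (EdeS.y0 lam k s) ∧
      ∀ y : ℝ → ℝ, EdeS.IsCauchySolution lam k s 1 0 y →
        Set.EqOn y (EdeS.y0 lam k s) (Set.Ici s)) ∧
    (EdeS.IsCauchySolution lam k s 0 1 (EdeS.y1 lam k s) ∧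
      ∀ y : ℝ → ℝ, EdeS.IsCauchySolution lam k s 0 1 y →
        Set.EqOn y (EdeS.y1 lam k s) (Set.Ici s)) := by
  have h0 := EdeS.isCauchySolution_y0 hk hlam hs
  have h1 := EdeS.isCauchySolution_y1 hk hlam hs
  exact ⟨⟨h0, fun y hy => by simpa using hy.eqOn h0 h1⟩,
    h1, fun y hy => by simpa using hy.eqOn h0 h1⟩

theorem proposition2p1 (k lam s : ℝ) (hk0 : 0 ≤ k) (hk1 : k < 1) (hlam : 0 < lam) (hs : 1 ≤ s) :
    (EdeS.IsCauchySolution lam k s 1 0 (EdeS.y0 lam k s) ∧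
      ∀ y : ℝ → ℝ, EdeS.IsCauchySolution lam k s 1 0 y →
        Set.EqOn y (EdeS.y0 lam k s) (Set.Ici s)) ∧
    (EdeS.IsCauchySolution lam k s 0 1 (EdeS.y1 lam k s) ∧
      ∀ y : ℝ → ℝ, EdeS.IsCauchySolution lam k s 0 1 y →
        Set.EqOn y (EdeS.y1 lam k s) (Set.Ici s)) :=
  proposition2p1_general k lam s hk1 hlam (zero_lt_one.trans_le hs)
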